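/- Let $(G,<)$ be an ordered group, i.e. a group with a total order such that $x<y$ implies $zx<zy$ and $xz<yz$ for all $x,y,z\in G$. Let $K$ be a skew field and let $K[\bar G;\sigma,\tau]$ be a crossed product of $G$ over $K$: an associative ring that contains $K$ and has as a right $K$-basis a copy $\bar G=\{\bar x\mid x\in G\}$ of $G$, with multiplication determined by $\bar x\bar y=\overline{xy}\,\tau(x,y)$ and $r\bar x=\bar x\,r^{\sigma(x)}$ for $x,y\in G$, $r\in K$, where $\tau\colon G\times G\to K\setminus\{0\}$ and $\sigma\colon G\to\mathrm{Aut}(K)$ are maps, normalised so that $\bar 1=1$. Let $K((\bar G;\sigma,\tau,<))$ be its Malcev-Neumann series ring, that is, the skew field of all formal series $\sum_{x\in G}\bar x a_x$ ($a_x\in K$) with well-ordered support, with componentwise addition and the product $$\Big(\sum_{x}\bar x a_x\Big)\Big(\sum_{x}\bar x b_x\Big)=\sum_{x}\bar x\Big(\sum_{yz=x}\tau(y,z)\,a_y^{\sigma(z)}\,b_z\Big),$$ and let $K(\bar G;\sigma,\tau)$ be the skew subfield of it generated by $K[\bar G;\sigma,\tau]$. Let $X$ be a subset of $G$ that consists of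 positive elements (that is, $1<x$ for all $x\in X$) and that is the basis of a noncommutative free submonoid of $G$. Then $K(\bar G;\sigma,\tau)$ contains a noncommutative free group algebra over its center $Z$. More precisely, the elements $1+\bar x$, $x\in X$, are pairwise distinct units of $K(\bar G;\sigma,\tau)$ and form a basis of a noncommutative free subgroup $H$ of the group of units of $K(\bar G;\sigma,\tau)$, and the natural $Z$-algebra homomorphism $Z[H]\to K(\bar G;\sigma,\tau)$ from the group algebra, which extends the inclusion of $H$, is injective. -/

import Mathlib

/-- A crossed product of a group `G` over a ring `K`: an associative ring `A` containing (via `incl`)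
the ring `K` and having as a (right) `K`-basis a copy `bar` of `G`, with multiplication determined by
the twisting `x̄ ȳ = \overline{xy} τ(x, y)` and the action `r x̄ = x̄ σ(x)(r)`, normalised (as is
always possible by a diagonal change of basis) so that `bar 1 = 1`. -/
structure CrossedProduct (K G A : Type*) [Ring K] [Group G] [Ring A] where
  incl : K →+* A
  bar : G → A
  σ : G → (K ≃+* K)
  τ : G → G → Kˣ
  bar_one : bar 1 = 1
  bar_mul_bar : ∀ x y, bar x * bar y = bar (x * y) * incl (τ x y)
  incl_mul_bar : ∀ r x, incl r * bar x = bar x * incl (σ x r)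
  basis : Function.Bijective (fun f : G →₀ K => f.sum fun x r => bar x * incl r)

namespace CrossedProduct

section Identities

variable {K G A : Type*} [Ring K] [Group G] [Ring A] (C : CrossedProduct K G A)

theorem monomial_injective (x : G) :
    Function.Injective (fun r : K => C.bar x * C.incl r) := by
  intro r s h
  have := C.basis.1 (a₁ := Finsupp.single x r) (a₂ := Finsupp.single x s) (by simpa using h)
  exact Finsupp.single_injective x this

theorem cocycle (x y z : G) :
    (C.τ (x * y) z : K) * C.σ z (C.τ x y) = C.τ x (y * z) * C.τ y z := by
  apply C.monomial_injective (x * y * z)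
  have h := mul_assoc (C.bar x) (C.bar y) (C.bar z)
  rw [C.bar_mul_bar x y, mul_assoc, C.incl_mul_bar, ← mul_assoc, C.bar_mul_bar, C.bar_mul_bar y z,
    ← mul_assoc (C.bar x), C.bar_mul_bar, ← mul_assoc x y z] at h
  simpa [mul_assoc] using h

theorem action (y z : G) (r : K) :
    C.σ (y * z) r * C.τ y z = C.τ y z * C.σ z (C.σ y r) := by
  apply C.monomial_injective (y * z)
  have h := mul_assoc (C.incl r) (C.bar y) (C.bar z)
  rw [C.incl_mul_bar, mul_assoc, C.incl_mul_bar, ← mul_assoc, C.bar_mul_bar, ← mul_assoc,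
    C.incl_mul_bar] at h
  simpa [mul_assoc] using h.symm

theorem τ_one_left (x : G) : (C.τ 1 x : K) = 1 := by
  apply C.monomial_injective x
  have h := C.bar_mul_bar 1 x
  rw [C.bar_one, one_mul, one_mul] at h
  simpa using h.symm

theorem τ_one_right (x : G) : (C.τ x 1 : K) = 1 := by
  apply C.monomial_injective x
  have h := C.bar_mul_bar x 1
  rw [C.bar_one, mul_one, mul_one] at h
  simpa using h.symm

theorem σ_one (r : K) : C.σ 1 r = r := by
  apply C.monomial_injective 1
  have h := C.incl_mul_bar r 1
  simpa [C.bar_one] using h.symm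

/-- The coefficients of an element of the crossed product with respect to the basis `bar`. -/
noncomputable def repr : A ≃ (G →₀ K) :=
  (Equiv.ofBijective _ C.basis).symm

theorem repr_symm_apply (p : G →₀ K) :
    C.repr.symm p = p.sum fun x r => C.bar x * C.incl r := rfl

theorem repr_symm_add (p q : G →₀ K) :
    C.repr.symm (p + q) = C.repr.symm p + C.repr.symm q := by
  simp only [C.repr_symm_apply]
  exact Finsupp.sum_add_index' (by simp) (by simp [mul_add])

theorem repr_symm_single (x : G) (r : K) :
    C.repr.symm (Finsupp.single x r) = C.bar x * C.incl r := by
  simp [C.repr_symm_apply]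

theorem repr_add (a b : A) : C.repr (a + b) = C.repr a + C.repr b := by
  apply C.repr.symm.injective
  simp [C.repr_symm_add]

theorem repr_zero : C.repr 0 = 0 := by
  have h := C.repr_add 0 0
  rw [add_zero] at h
  exact left_eq_add.mp h

theorem repr_monomial (x : G) (r : K) :
    C.repr (C.bar x * C.incl r) = Finsupp.single x r := by
  rw [← C.repr_symm_single, Equiv.apply_symm_apply]

end Identities

/-- The elements of the Malcev-Neumann series ring: formal series `∑ x̄ a_x` whose support is a
well-ordered subset of `G`. -/
@[ext]
structure Series {K G A : Type*} [Ring K] [Group G] [LinearOrder G] [Ring A]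
    (C : CrossedProduct K G A) where
  coeff : G → K
  isWF_support : (Function.support coeff).IsWF

section OrderFacts

variable {G : Type*} [Group G] [LinearOrder G] [MulLeftStrictMono G] [MulRightStrictMono G]

theorem isPWO_mul {s t : Set G} (hs : s.IsPWO) (ht : t.IsPWO) :
    (Set.image2 (· * ·) s t).IsPWO := by
  have := mulLeftMono_of_mulLeftStrictMono G
  have := mulRightMono_of_mulRightStrictMono G
  rw [← Set.image_prod]
  exact (hs.prod ht).image_of_monotone (fun a b h => mul_le_mul' h.1 h.2)

theorem finite_antidiagonal {s t : Set G} (hs : s.IsPWO) (ht : t.IsPWO) (x : G) :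
    {y | y ∈ s ∧ y⁻¹ * x ∈ t}.Finite := by
  have := mulLeftMono_of_mulLeftStrictMono G
  have := mulRightMono_of_mulRightStrictMono G
  have : IsOrderedCancelSMul G G :=
    { smul_le_smul_left := fun a b h c => mul_le_mul_right h c
      smul_le_smul_right := fun a b h c => mul_le_mul_left h c
      le_of_smul_le_smul_left := fun a b c h => le_of_mul_le_mul_left' h
      le_of_smul_le_smul_right := fun a b c h => le_of_mul_le_mul_right' h }
  refine ((Set.SMulAntidiagonal.finite_of_isPWO hs ht x).image Prod.fst).subset ?_
  rintro y ⟨h1, h2⟩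
  exact ⟨(y, y⁻¹ * x), ⟨h1, h2, by simp⟩, rfl⟩

theorem isPWO_closure {s : Set G} (hs : s.IsPWO) (hpos : ∀ x ∈ s, 1 ≤ x) :
    (Submonoid.closure s : Set G).IsPWO := by
  have := mulLeftMono_of_mulLeftStrictMono G
  have := mulRightMono_of_mulRightStrictMono G
  rw [Submonoid.closure_eq_image_prod]
  refine (hs.partiallyWellOrderedOn_sublistForall₂ (· ≤ ·)).image_of_monotone_on ?_
  exact fun l1 _ l2 hl2 h12 => h12.prod_le_prod' fun x hx => hpos x <| hl2 x hx

end OrderFacts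

namespace Series

section Additive

variable {K G A : Type*} [Ring K] [Group G] [LinearOrder G] [Ring A] {C : CrossedProduct K G A}

theorem isPWO_support (f : C.Series) : (Function.support f.coeff).IsPWO := f.isWF_support.isPWO

instance : Zero C.Series := ⟨⟨0, by simp⟩⟩

instance : Add C.Series :=
  ⟨fun f g => ⟨f.coeff + g.coeff,
    (f.isPWO_support.union g.isPWO_support).isWF.mono (Function.support_add _ _)⟩⟩

instance : Neg C.Series :=
  ⟨fun f => ⟨-f.coeff, by rw [Function.support_neg]; exact f.isWF_support⟩⟩

@[simp] theorem coeff_zero : (0 : C.Series).coeff = 0 := rfl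
@[simp] theorem coeff_add (f g : C.Series) : (f + g).coeff = f.coeff + g.coeff := rfl
@[simp] theorem coeff_neg (f : C.Series) : (-f).coeff = -f.coeff := rfl

instance addCommGroup : AddCommGroup C.Series where
  add_assoc f g h := by ext; simp [add_assoc]
  zero_add f := by ext; simp
  add_zero f := by ext; simp
  add_comm f g := by ext; simp [add_comm]
  neg_add_cancel f := by ext; simp
  nsmul := nsmulRec
  zsmul := zsmulRec

open Classical in
/-- The one-term series `x̄ a`. -/
noncomputable def single (C : CrossedProduct K G A) (x : G) (a : K) : C.Series :=
  ⟨Pi.single x a, (Set.finite_singleton x).isWF.mono Pi.support_single_subset⟩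

noncomputable instance : One C.Series := ⟨single C 1 1⟩

theorem single_self (x : G) (a : K) : (single C x a).coeff x = a := by simp [single]

theorem single_of_ne {x y : G} (a : K) (h : y ≠ x) : (single C x a).coeff y = 0 := by
  simp [single, h]

theorem one_def : (1 : C.Series) = single C 1 1 := rfl

/-- A finite formal sum, seen as a series. -/
def ofFinsupp (C : CrossedProduct K G A) (p : G →₀ K) : C.Series :=
  ⟨p, p.hasFiniteSupport.isWF⟩

theorem ofFinsupp_add (p q : G →₀ K) :
    ofFinsupp C (p + q) = ofFinsupp C p + ofFinsupp C q := rfl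

theorem ofFinsupp_zero : ofFinsupp C 0 = 0 := rfl

theorem ofFinsupp_single (x : G) (r : K) : ofFinsupp C (Finsupp.single x r) = single C x r := by
  ext y
  by_cases h : y = x
  · subst h; simp [ofFinsupp, single_self]
  · rw [single_of_ne _ h]
    simp [ofFinsupp, h]

/-- The term `τ(y, z) σ(z)(a_y) b_z`, where `y z = x`, of the coefficient at `x` of the product of
`f = ∑ x̄ a_x` and `g = ∑ x̄ b_x`. -/
def mulTerm (f g : C.Series) (x y : G) : K :=
  C.τ y (y⁻¹ * x) * C.σ (y⁻¹ * x) (f.coeff y) * g.coeff (y⁻¹ * x)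

theorem mulTerm_support (f g : C.Series) (x : G) : Function.support (mulTerm f g x) ⊆
    {y | y ∈ Function.support f.coeff ∧ y⁻¹ * x ∈ Function.support g.coeff} := by
  intro y hy
  refine ⟨fun h => hy ?_, fun h => hy ?_⟩ <;> simp [mulTerm, h]

end Additive

section Multiplicative

variable {K G A : Type*} [Ring K] [Group G] [LinearOrder G] [MulLeftStrictMono G]
  [MulRightStrictMono G] [Ring A] {C : CrossedProduct K G A}

theorem mulTerm_finite (f g : C.Series) (x : G) : (mulTerm f g x).HasFiniteSupport :=
  (finite_antidiagonal f.isPWO_support g.isPWO_support x).subset (mulTerm_support f g x)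

/-- `(∑ x̄ a_x) (∑ x̄ b_x) = ∑ x̄ (∑_{y z = x} τ(y, z) σ(z)(a_y) b_z)`; the inner sum is finite by
`mulTerm_finite`. -/
noncomputable instance : Mul C.Series :=
  ⟨fun f g => ⟨fun x => ∑ᶠ y, mulTerm f g x y, by
    refine ((isPWO_mul f.isPWO_support g.isPWO_support).mono ?_).isWF
    intro x hx
    obtain ⟨y, hy⟩ : ∃ y, mulTerm f g x y ≠ 0 := by
      by_contra! h0
      exact hx (finsum_eq_zero_of_forall_eq_zero h0)
    obtain ⟨h1, h2⟩ := mulTerm_support f g x hy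
    exact ⟨y, h1, _, h2, by simp⟩⟩⟩

theorem coeff_mul (f g : C.Series) (x : G) : (f * g).coeff x = ∑ᶠ y, mulTerm f g x y := rfl

theorem single_mul_coeff (x : G) (a : K) (f : C.Series) (w : G) :
    (single C x a * f).coeff w = C.τ x (x⁻¹ * w) * C.σ (x⁻¹ * w) a * f.coeff (x⁻¹ * w) := by
  rw [coeff_mul, finsum_eq_single _ x]
  · simp [mulTerm, single_self]
  · intro y hy
    simp [mulTerm, single_of_ne _ hy]

theorem mul_single_coeff (x : G) (a : K) (f : C.Series) (w : G) :
    (f * single C x a).coeff w = C.τ (w * x⁻¹) x * C.σ x (f.coeff (w * x⁻¹)) * a := by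
  rw [coeff_mul, finsum_eq_single _ (w * x⁻¹)]
  · simp [mulTerm, single_self]
  · intro y hy
    have : y⁻¹ * w ≠ x := by
      rintro rfl
      simp at hy
    simp [mulTerm, single_of_ne _ this]

theorem single_mul_single (x y : G) (a b : K) :
    single C x a * single C y b = single C (x * y) (C.τ x y * C.σ y a * b) := by
  ext w
  rw [single_mul_coeff]
  by_cases h : w = x * y
  · subst h; simp [single_self]
  · rw [single_of_ne _ h, single_of_ne, mul_zero]
    rintro rfl
    simp at h

protected theorem mul_assoc (f g h : C.Series) : f * g * h = f * (g * h) := by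
  ext x
  let F : G × G → K := fun p =>
    C.τ p.1 (p.1⁻¹ * x) * C.σ (p.1⁻¹ * x) (mulTerm f g p.1 p.2) * h.coeff (p.1⁻¹ * x)
  let F' : G × G → K := fun p =>
    C.τ p.1 (p.1⁻¹ * x) * C.σ (p.1⁻¹ * x) (f.coeff p.1) * mulTerm g h (p.1⁻¹ * x) p.2
  have hFF' : ∀ p : G × G, F (p.1 * p.2, p.1) = F' p := by
    rintro ⟨y, v⟩
    obtain ⟨z, rfl⟩ : ∃ z, x = y * (v * z) := ⟨v⁻¹ * (y⁻¹ * x), by simp⟩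
    have e1 : (y * v)⁻¹ * (y * (v * z)) = z := by group
    have e2 : y⁻¹ * (y * v) = v := by group
    have e3 : y⁻¹ * (y * (v * z)) = v * z := by group
    have e4 : v⁻¹ * (v * z) = z := by group
    simp only [F, F', mulTerm, e1, e2, e3, e4, map_mul]
    have h1 := C.cocycle y v z
    have h2 := C.action v z (f.coeff y)
    simp only [← mul_assoc]
    rw [h1, mul_assoc (C.τ y (v * z) : K) (C.σ (v * z) _), h2]
    simp only [mul_assoc]
  have hF'fin : F'.HasFiniteSupport := by
    have hgh := isPWO_mul g.isPWO_support h.isPWO_support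
    have h1 := finite_antidiagonal f.isPWO_support hgh x
    refine (h1.biUnion (t := fun y => (fun v => (y, v)) '' Function.support
      (mulTerm g h (y⁻¹ * x))) fun y _ => (mulTerm_finite g h _).image _).subset ?_
    rintro ⟨y, v⟩ hp
    have hy : f.coeff y ≠ 0 := fun h0 => hp (by simp [F', h0])
    have hv : mulTerm g h (y⁻¹ * x) v ≠ 0 := fun h0 => hp (by simp [F', h0])
    obtain ⟨a, b⟩ := mulTerm_support _ _ _ hv
    simp only [Set.mem_iUnion]
    exact ⟨y, ⟨hy, ⟨v, a, _, b, by simp⟩⟩, v, hv, rfl⟩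
  let e : G × G ≃ G × G :=
    { toFun := fun p => (p.1 * p.2, p.1)
      invFun := fun p => (p.2, p.2⁻¹ * p.1)
      left_inv := fun p => by simp
      right_inv := fun p => by simp }
  have hFe : F' = F ∘ e := by
    funext p
    exact (hFF' p).symm
  have hFfin : F.HasFiniteSupport := by
    have : F = F' ∘ e.symm := by
      rw [hFe]; funext p; simp
    rw [this]
    exact hF'fin.preimage e.symm.injective.injOn
  have hL : (f * g * h).coeff x = ∑ᶠ p, F p := by
    rw [finsum_curry F hFfin, coeff_mul]
    refine finsum_congr fun u => ?_
    change C.τ u (u⁻¹ * x) * C.σ (u⁻¹ * x) ((f * g).coeff u) * h.coeff (u⁻¹ * x) = _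
    rw [coeff_mul, map_finsum (C.σ (u⁻¹ * x)) (mulTerm_finite f g u), mul_finsum', finsum_mul']
    · refine (mulTerm_finite f g u).subset fun y hy h0 => hy ?_
      simp [h0]
    · refine (mulTerm_finite f g u).subset fun y hy h0 => hy ?_
      simp [h0]
  have hR : (f * (g * h)).coeff x = ∑ᶠ p, F' p := by
    rw [finsum_curry F' hF'fin, coeff_mul]
    refine finsum_congr fun u => ?_
    change C.τ u (u⁻¹ * x) * C.σ (u⁻¹ * x) (f.coeff u) * (g * h).coeff (u⁻¹ * x) = _
    rw [coeff_mul, mul_finsum' _ _ (mulTerm_finite g h _)]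
  rw [hL, hR, hFe]
  exact (finsum_comp_equiv e).symm

noncomputable instance : Ring C.Series where
  __ := addCommGroup
  mul_assoc := Series.mul_assoc
  one_mul f := by
    ext x
    rw [one_def, single_mul_coeff]
    simp [C.τ_one_left]
  mul_one f := by
    ext x
    rw [one_def, mul_single_coeff]
    simp [C.τ_one_right, C.σ_one]
  zero_mul f := by
    ext x
    simp [coeff_mul, mulTerm]
  mul_zero f := by
    ext x
    simp [coeff_mul, mulTerm]
  left_distrib f g h := by
    ext x
    simp only [coeff_mul, coeff_add, Pi.add_apply]
    rw [← finsum_add_distrib (mulTerm_finite _ _ _) (mulTerm_finite _ _ _)]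
    exact finsum_congr fun y => by simp [mulTerm, mul_add]
  right_distrib f g h := by
    ext x
    simp only [coeff_mul, coeff_add, Pi.add_apply]
    rw [← finsum_add_distrib (mulTerm_finite _ _ _) (mulTerm_finite _ _ _)]
    exact finsum_congr fun y => by simp [mulTerm, mul_add, add_mul]

theorem ofFinsupp_repr_mul (a b : A) : ofFinsupp C (C.repr (a * b)) =
    ofFinsupp C (C.repr a) * ofFinsupp C (C.repr b) := by
  obtain ⟨p, rfl⟩ := C.repr.symm.surjective a
  obtain ⟨q, rfl⟩ := C.repr.symm.surjective b
  induction p using Finsupp.induction_linear with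
  | zero => simp [C.repr_symm_apply, C.repr_zero, ofFinsupp_zero]
  | add p p' hp hp' =>
    rw [C.repr_symm_add, add_mul, C.repr_add, ofFinsupp_add, hp, hp', C.repr_add, ofFinsupp_add, add_mul]
  | single x r =>
    induction q using Finsupp.induction_linear with
    | zero => simp [C.repr_symm_apply, C.repr_zero, ofFinsupp_zero]
    | add q q' hq hq' =>
      rw [C.repr_symm_add, mul_add, C.repr_add, ofFinsupp_add, hq, hq', C.repr_add, ofFinsupp_add,
        mul_add]
    | single y u =>
      have : C.bar x * C.incl r * (C.bar y * C.incl u) =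
          C.bar (x * y) * C.incl (C.τ x y * C.σ y r * u) := by
        rw [mul_assoc, ← mul_assoc (C.incl r), C.incl_mul_bar, ← mul_assoc, ← mul_assoc,
          C.bar_mul_bar]
        simp [mul_assoc]
      rw [C.repr_symm_single, C.repr_symm_single, this, C.repr_monomial, C.repr_monomial, C.repr_monomial,
        ofFinsupp_single, ofFinsupp_single, ofFinsupp_single, single_mul_single]

/-- The embedding of the crossed product into its Malcev-Neumann series ring, sending the finite sum
`∑ x̄ r_x` to the series with the same coefficients. -/
noncomputable def ofCrossedProduct (C : CrossedProduct K G A) : A →+* C.Series where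
  toFun a := ofFinsupp C (C.repr a)
  map_one' := by
    have : (1 : A) = C.bar 1 * C.incl 1 := by simp [C.bar_one]
    rw [this, C.repr_monomial, ofFinsupp_single, one_def]
  map_mul' := ofFinsupp_repr_mul
  map_zero' := by rw [C.repr_zero, ofFinsupp_zero]
  map_add' a b := by rw [C.repr_add, ofFinsupp_add]

theorem ofCrossedProduct_monomial (x : G) (r : K) :
    ofCrossedProduct C (C.bar x * C.incl r) = single C x r := by
  change ofFinsupp C (C.repr _) = _
  rw [C.repr_monomial, ofFinsupp_single]

theorem ofCrossedProduct_injective : Function.Injective (ofCrossedProduct C) := by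
  intro a b h
  apply C.repr.injective
  apply DFunLike.coe_injective
  exact congrArg Series.coeff h

end Multiplicative

section SkewField

variable {K G A : Type*} [DivisionRing K] [Group G] [LinearOrder G] [MulLeftStrictMono G]
  [MulRightStrictMono G] [Ring A] {C : CrossedProduct K G A}

theorem exists_right_inverse (f : C.Series) (hf : f ≠ 0) : ∃ h : C.Series, f * h = 1 := by
  classical
  have hne : (Function.support f.coeff).Nonempty := by
    rw [Function.support_nonempty_iff]
    intro h0
    exact hf (Series.ext h0)
  let m : G := f.isWF_support.min hne
  have hm : f.coeff m ≠ 0 := f.isWF_support.min_mem hne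
  have hmin : ∀ y, f.coeff y ≠ 0 → m ≤ y := fun y hy => f.isWF_support.min_le hne hy
  have hlm := mulLeftMono_of_mulLeftStrictMono G
  have hrm := mulRightMono_of_mulRightStrictMono G
  let S : Set G := (fun y => m⁻¹ * y) '' Function.support f.coeff
  have hS : S.IsPWO := f.isPWO_support.image_of_monotone fun a b hab => mul_le_mul_right hab _
  have hS1 : ∀ x ∈ S, 1 ≤ x := by
    rintro _ ⟨y, hy, rfl⟩
    simpa using hmin y hy
  let T : Set G := (fun y => y * m⁻¹) '' (Submonoid.closure S : Set G)
  have hT : T.IsWF := ((isPWO_closure hS hS1).image_of_monotone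
    fun a b hab => mul_le_mul_left hab _).isWF
  have hTm : m⁻¹ ∈ T := ⟨1, one_mem _, by simp⟩
  have hST : ∀ y z, f.coeff y ≠ 0 → z ∈ T → m⁻¹ * y * z ∈ T := by
    rintro y _ hy ⟨w, hw, rfl⟩
    exact ⟨m⁻¹ * y * w, mul_mem (Submonoid.subset_closure ⟨y, hy, rfl⟩) hw, by simp [mul_assoc]⟩
  let u : G → K := fun z => C.τ m z * C.σ z (f.coeff m)
  have hu : ∀ z, u z ≠ 0 := fun z => mul_ne_zero (C.τ m z).ne_zero (by simpa using hm)
  let c : G → G → K := fun z y => C.τ y (y⁻¹ * (m * z)) * C.σ (y⁻¹ * (m * z)) (f.coeff y)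
  have wf : WellFounded (fun a b : T => (a : G) < b) := hT
  let rec' : ∀ z : T, (∀ z' : T, (z' : G) < z → K) → K := fun z h =>
    (u z)⁻¹ * ((if (z : G) = m⁻¹ then 1 else 0) - ∑ᶠ y : G,
      if hy : y⁻¹ * (m * z) ∈ T ∧ y⁻¹ * (m * (z : G)) < z then
        c z y * h ⟨_, hy.1⟩ hy.2 else 0)
  let h0 : T → K := wf.fix rec'
  have h0eq : ∀ z, h0 z = (u z)⁻¹ * ((if (z : G) = m⁻¹ then 1 else 0) - ∑ᶠ y : G,
      if hy : y⁻¹ * (m * z) ∈ T ∧ y⁻¹ * (m * (z : G)) < z then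
        c z y * h0 ⟨_, hy.1⟩ else 0) := fun z => wf.fix_eq rec' z
  let h : C.Series := ⟨fun z => if hz : z ∈ T then h0 ⟨z, hz⟩ else 0, hT.mono (by
    intro z hz
    by_contra hzT
    exact hz (by simp [hzT]))⟩
  have hhT : ∀ z (hz : z ∈ T), h.coeff z = h0 ⟨z, hz⟩ := fun z hz => by simp [h, hz]
  have hhT' : ∀ z, z ∉ T → h.coeff z = 0 := fun z hz => by simp [h, hz]
  refine ⟨h, ?_⟩
  ext x
  obtain ⟨z, rfl⟩ : ∃ z, x = m * z := ⟨m⁻¹ * x, by simp⟩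
  rw [coeff_mul]
  have hone : (1 : C.Series).coeff (m * z) = if z = m⁻¹ then 1 else 0 := by
    split_ifs with hz
    · subst hz; simp [one_def, single_self]
    · rw [one_def, single_of_ne]
      intro h1
      exact hz (eq_inv_of_mul_eq_one_right h1)
  rw [hone]
  by_cases hz : z ∈ T
  · rw [← add_finsum_cond_ne m (mulTerm_finite f h (m * z))]
    have e1 : mulTerm f h (m * z) m = u z * h0 ⟨z, hz⟩ := by
      simp [mulTerm, u, hhT z hz]
    rw [e1, h0eq ⟨z, hz⟩, mul_inv_cancel_left₀ (hu z)]
    have e2 : ∀ y, (∑ᶠ _ : y ≠ m, mulTerm f h (m * z) y) =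
        if hy : y⁻¹ * (m * z) ∈ T ∧ y⁻¹ * (m * z) < z then
        c z y * h0 ⟨_, hy.1⟩ else 0 := by
      intro y
      split_ifs with hy
      · have hym : y ≠ m := by
          rintro rfl
          simp at hy
        simp [hym, mulTerm, c, hhT _ hy.1]
      · by_cases hym : y = m
        · simp [hym]
        · simp only [ne_eq, hym, not_false_eq_true, finsum_true]
          by_cases hfy : f.coeff y = 0
          · simp [mulTerm, hfy]
          · have hlt : m < y := lt_of_le_of_ne (hmin y hfy) (Ne.symm hym)
            have hlt' : y⁻¹ * (m * z) < z := by
              rw [inv_mul_lt_iff_lt_mul]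
              exact mul_lt_mul_left hlt z
            have : y⁻¹ * (m * z) ∉ T := fun hT' => hy ⟨hT', hlt'⟩
            simp [mulTerm, hhT' _ this]
    rw [finsum_congr e2]
    simp
  · have hzm : z ≠ m⁻¹ := fun h1 => hz (h1 ▸ hTm)
    rw [if_neg hzm]
    refine finsum_eq_zero_of_forall_eq_zero fun y => ?_
    by_cases hfy : f.coeff y = 0
    · simp [mulTerm, hfy]
    · have : y⁻¹ * (m * z) ∉ T := fun hT' => hz (by
        have := hST y _ hfy hT'
        simpa [mul_assoc] using this)
      simp [mulTerm, hhT' _ this]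

instance : Nontrivial C.Series :=
  ⟨0, 1, fun h => by
    have := congrArg (fun f : C.Series => f.coeff 1) h
    simp [one_def, single_self] at this⟩

theorem isUnit_or_eq_zero (f : C.Series) : IsUnit f ∨ f = 0 := by
  by_cases hf : f = 0
  · exact Or.inr hf
  · left
    obtain ⟨g, hg⟩ := exists_right_inverse f hf
    have hg0 : g ≠ 0 := by
      rintro rfl
      simp at hg
    obtain ⟨k, hk⟩ := exists_right_inverse g hg0
    have : f = k := by
      calc f = f * (g * k) := by rw [hk, mul_one]
        _ = k := by rw [← mul_assoc, hg, one_mul]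
    exact ⟨⟨f, g, hg, by rw [this]; exact hk⟩, rfl⟩

/-- Over a skew field, the Malcev-Neumann series ring is a skew field. -/
noncomputable instance : DivisionRing C.Series :=
  DivisionRing.ofIsUnitOrEqZero isUnit_or_eq_zero

end SkewField

end Series

section Fractions

variable {K G A : Type*} [DivisionRing K] [Group G] [LinearOrder G] [MulLeftStrictMono G]
  [MulRightStrictMono G] [Ring A]

/-- The Malcev-Neumann skew field of fractions of a crossed product: the skew subfield of the
Malcev-Neumann series ring generated by the crossed product. -/
noncomputable def fractions (C : CrossedProduct K G A) : Subfield C.Series :=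
  Subfield.closure (Set.range (Series.ofCrossedProduct C))

/-- The embedding of a crossed product into its Malcev-Neumann skew field of fractions. -/
noncomputable def toFractions (C : CrossedProduct K G A) : A →+* C.fractions :=
  (Series.ofCrossedProduct C).codRestrict C.fractions fun a =>
    Subfield.subset_closure ⟨a, rfl⟩

end Fractions

end CrossedProduct

/-! Let `F` be the free group on `X`, and let `φ` be the `Z`-algebra map from `Z[F]` that sends each
`x` to `1 + x̄`. Two independent facts give its injectivity.

Algebra: every `a` in `Z[F]` has a Fox expansion `a = c + ∑ (i - 1) dᵢ` with `c` in `Z`. Suppose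
that a relation `c + ∑ (φ i - 1) φ(dᵢ) = 0` always forces `c = 0` and `φ(dᵢ) = 0`. If `φ a = 0`,
then each `φ(dᵢ)` vanishes; since the `dᵢ` involve words that are shorter, at least after
multiplication by `i`, induction gives `a = 0` (`injective_of_fox_independent`).

Supports: here `φ x - 1 = x̄`. Let `N` be the product of the submonoid generated by `X` and the
center of `G`. Central elements of the skew field have support in the center of `G`
(`mem_center_of_commute`), and positivity of `x` puts the support of `(1 + x̄)⁻¹` in `N`
(`inverse_mem_supportedSubring`). So the image of `φ` is supported in `N`, and `x̄ φ(dₓ)` in `x N`.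
By freeness, the sets `x N` are pairwise disjoint and miss the center of `G`, so nothing can cancel
(`eq_zero_of_add_sum_single_mul_eq_zero`). -/

section FoxCalculus

/-! ### Fox calculus in the group algebra of a free group. -/

open MonoidAlgebra in
/-- The right Fox derivatives of a word `w` in the free group: the coefficients `∂ᵢ w` in
`w = 1 + ∑ i, (i - 1) * ∂ᵢ w`. -/
noncomputable def foxDeriv (Z : Type*) {X : Type*} [CommRing Z] :
    List (X × Bool) → (X →₀ MonoidAlgebra Z (FreeGroup X))
  | [] => 0
  | (i, true) :: L => foxDeriv Z L + Finsupp.single i (of Z _ (FreeGroup.mk L))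
  | (i, false) :: L => foxDeriv Z L - Finsupp.single i (of Z _ (FreeGroup.mk ((i, false) :: L)))

/-- The span in the group algebra of the free group of the elements given by a set of words. -/
noncomputable def wordSpan (Z : Type*) {X : Type*} [CommRing Z] (S : Set (List (X × Bool))) :
    Submodule Z (MonoidAlgebra Z (FreeGroup X)) :=
  Submodule.span Z ((fun L => MonoidAlgebra.of Z (FreeGroup X) (FreeGroup.mk L)) '' S)

/-- Words of length less than `n`. -/
def shortWords (X : Type*) (n : ℕ) : Set (List (X × Bool)) := {L | L.length < n}

/-- Words of length less than `n`, and words of length at most `n` whose first letter is a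
generator. -/
def positiveWords (X : Type*) (n : ℕ) : Set (List (X × Bool)) :=
  {L | L.length < n ∨ ∃ i L', L = (i, true) :: L' ∧ L'.length < n}

variable {Z X : Type*} [CommRing Z]

theorem mem_wordSpan {S : Set (List (X × Bool))} {L : List (X × Bool)} (h : L ∈ S) :
    MonoidAlgebra.of Z (FreeGroup X) (FreeGroup.mk L) ∈ wordSpan Z S :=
  Submodule.subset_span ⟨L, h, rfl⟩

theorem wordSpan_mono {S T : Set (List (X × Bool))} (h : S ⊆ T) :
    wordSpan Z S ≤ wordSpan Z T :=
  Submodule.span_mono (Set.image_mono h)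

theorem of_mk_cons_true (i : X) (L : List (X × Bool)) :
    MonoidAlgebra.of Z (FreeGroup X) (FreeGroup.mk ((i, true) :: L)) =
      MonoidAlgebra.of Z _ (FreeGroup.of i) * MonoidAlgebra.of Z _ (FreeGroup.mk L) := by
  rw [← map_mul]; rfl

theorem of_mul_of_mk_cons_false (i : X) (L : List (X × Bool)) :
    MonoidAlgebra.of Z _ (FreeGroup.of i) *
      MonoidAlgebra.of Z (FreeGroup X) (FreeGroup.mk ((i, false) :: L)) =
      MonoidAlgebra.of Z _ (FreeGroup.mk L) := by
  rw [← map_mul]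
  congr 1
  have : FreeGroup.mk ((i, false) :: L) = (FreeGroup.of i)⁻¹ * FreeGroup.mk L := by
    rw [FreeGroup.of, FreeGroup.inv_mk, FreeGroup.mul_mk]; rfl
  rw [this, mul_inv_cancel_left]

theorem foxDeriv_sum (L : List (X × Bool)) :
    MonoidAlgebra.of Z (FreeGroup X) (FreeGroup.mk L) =
      1 + (foxDeriv Z L).sum fun i b => (MonoidAlgebra.of Z _ (FreeGroup.of i) - 1) * b := by
  induction L with
  | nil => simp [foxDeriv, ← FreeGroup.one_eq_mk, MonoidAlgebra.one_def]
  | cons p L ih =>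
    obtain ⟨i, _ | _⟩ := p
    · rw [foxDeriv, Finsupp.sum_sub_index (fun _ _ _ => mul_sub _ _ _),
        Finsupp.sum_single_index (mul_zero _), add_sub, ← ih, sub_mul, of_mul_of_mk_cons_false]
      simp
    · rw [foxDeriv, Finsupp.sum_add_index' (fun _ => mul_zero _) (fun _ _ _ => mul_add _ _ _),
        Finsupp.sum_single_index (mul_zero _), ← add_assoc, ← ih, of_mk_cons_true, sub_mul]
      simp

/-- A generator contributes the suffix after it, an inverse letter the suffix that starts with it.
So the full length of `L` is reached only when `L` begins with an inverse letter. -/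
theorem foxDeriv_mem_shortWords (L : List (X × Bool)) (i : X) :
    foxDeriv Z L i ∈ wordSpan Z (shortWords X (L.length + 1)) := by
  induction L with
  | nil => simp [foxDeriv]
  | cons p L ih =>
    have hL : foxDeriv Z L i ∈ wordSpan Z (shortWords X ((p :: L).length + 1)) :=
      wordSpan_mono (fun _ h => by simp [shortWords] at h ⊢; omega) ih
    obtain ⟨j, _ | _⟩ := p
    · rw [foxDeriv, Finsupp.sub_apply]
      refine sub_mem hL ?_
      classical
      rw [Finsupp.single_apply]
      split_ifs
      · exact mem_wordSpan (by simp [shortWords])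
      · exact zero_mem _
    · rw [foxDeriv, Finsupp.add_apply]
      refine add_mem hL ?_
      classical
      rw [Finsupp.single_apply]
      split_ifs
      · exact mem_wordSpan (by simp [shortWords])
      · exact zero_mem _

/-- A leading generator is dropped by differentiation, so even the words of length `n` in
`positiveWords` lose a letter. This is the first half of the induction on length. -/
theorem foxDeriv_mem_of_positive {n : ℕ} {L : List (X × Bool)} (hL : L ∈ positiveWords X n)
    (i : X) : foxDeriv Z L i ∈ wordSpan Z (shortWords X n) := by
  rcases hL with hL | ⟨j, L, rfl, hL⟩
  · exact wordSpan_mono (fun _ h => by simp [shortWords] at h ⊢; omega)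
      (foxDeriv_mem_shortWords L i)
  · rw [foxDeriv, Finsupp.add_apply]
    refine add_mem (wordSpan_mono (fun _ h => by simp [shortWords] at h ⊢; omega)
      (foxDeriv_mem_shortWords L i)) ?_
    classical
    rw [Finsupp.single_apply]
    split_ifs
    · exact mem_wordSpan (by simpa [shortWords])
    · exact zero_mem _

/-- The second half of the induction. A suffix that starts with `i⁻¹` loses that letter when
multiplied by `i`; the other suffixes in the derivative have length less than `n` and acquire the
leading generator `i`. -/
theorem of_mul_foxDeriv_mem {n : ℕ} {L : List (X × Bool)} (hL : L.length ≤ n) (i : X) :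
    MonoidAlgebra.of Z _ (FreeGroup.of i) * foxDeriv Z L i ∈ wordSpan Z (positiveWords X n) := by
  induction L with
  | nil => simp [foxDeriv]
  | cons p L ih =>
    have hL' : L.length < n := by simp at hL; omega
    obtain ⟨j, _ | _⟩ := p
    · rw [foxDeriv, Finsupp.sub_apply, mul_sub]
      refine sub_mem (ih hL'.le) ?_
      classical
      rw [Finsupp.single_apply]
      split_ifs with h
      · rw [h, of_mul_of_mk_cons_false]
        exact mem_wordSpan (Or.inl hL')
      · simp
    · rw [foxDeriv, Finsupp.add_apply, mul_add]
      refine add_mem (ih hL'.le) ?_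
      classical
      rw [Finsupp.single_apply]
      split_ifs with h
      · rw [← of_mk_cons_true]
        exact mem_wordSpan (Or.inr ⟨i, L, rfl, hL'⟩)
      · simp

/-- Linear extension of `foxDeriv_sum`. The constraint `Q` depends on the generator because one use
bounds `i * dᵢ` rather than `dᵢ`. -/
theorem exists_fox_decomposition {S : Set (List (X × Bool))}
    {Q : X → Submodule Z (MonoidAlgebra Z (FreeGroup X))}
    (hQ : ∀ L ∈ S, ∀ i, foxDeriv Z L i ∈ Q i) {a : MonoidAlgebra Z (FreeGroup X)}
    (ha : a ∈ wordSpan Z S) :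
    ∃ (c : Z) (d : X →₀ MonoidAlgebra Z (FreeGroup X)), (∀ i, d i ∈ Q i) ∧
      a = algebraMap Z _ c + d.sum fun i b => (MonoidAlgebra.of Z _ (FreeGroup.of i) - 1) * b := by
  induction ha using Submodule.span_induction with
  | mem _ h =>
    obtain ⟨L, hL, rfl⟩ := h
    exact ⟨1, foxDeriv Z L, hQ L hL, by rw [map_one]; exact foxDeriv_sum L⟩
  | zero => exact ⟨0, 0, fun _ => zero_mem _, by simp⟩
  | add a b _ _ iha ihb =>
    obtain ⟨c, d, hd, rfl⟩ := iha
    obtain ⟨c', d', hd', rfl⟩ := ihb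
    refine ⟨c + c', d + d', fun i => add_mem (hd i) (hd' i), ?_⟩
    rw [Finsupp.sum_add_index' (fun _ => mul_zero _) (fun _ _ _ => mul_add _ _ _), map_add]
    abel
  | smul r a _ iha =>
    obtain ⟨c, d, hd, rfl⟩ := iha
    refine ⟨r * c, r • d, fun i => Submodule.smul_mem _ r (hd i), ?_⟩
    rw [Finsupp.sum_smul_index' (fun _ => mul_zero _), smul_add, map_mul, Algebra.smul_def,
      Finsupp.smul_sum]
    simp

/-- An algebra homomorphism from the group algebra of a free group is injective as soon as the
scalars and the right multiples of the images of `i - 1`, for `i` a generator, form a direct sum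
in its image. -/
theorem injective_of_fox_independent {D : Type*} [Ring D] [Algebra Z D]
    (φ : MonoidAlgebra Z (FreeGroup X) →ₐ[Z] D)
    (hφ : ∀ (c : Z) (d : X →₀ MonoidAlgebra Z (FreeGroup X)),
      algebraMap Z D c +
        (d.sum fun i b => (φ (MonoidAlgebra.of Z _ (FreeGroup.of i)) - 1) * φ b) = 0 →
      c = 0 ∧ ∀ i, φ (d i) = 0) :
    Function.Injective φ := by
  have key : ∀ (c : Z) (d : X →₀ MonoidAlgebra Z (FreeGroup X)),
      φ (algebraMap Z _ c +
        d.sum fun i b => (MonoidAlgebra.of Z _ (FreeGroup.of i) - 1) * b) = 0 →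
      c = 0 ∧ ∀ i, φ (d i) = 0 := by
    intro c d h
    refine hφ c d ?_
    rw [map_add, AlgHom.commutes] at h
    simpa [Finsupp.sum, map_sum] using h
  have short : ∀ n, ∀ a ∈ wordSpan Z (shortWords X n), φ a = 0 → a = 0 := by
    intro n
    induction n with
    | zero =>
      intro a ha _
      simpa [wordSpan, shortWords] using ha
    | succ n ih =>
      -- The step from `n` to `n + 1` passes through `positiveWords X n`, since one Fox derivative
      -- need not shorten a word that starts with an inverse letter.
      have pos : ∀ a ∈ wordSpan Z (positiveWords X n), φ a = 0 → a = 0 := by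
        intro a ha h0
        obtain ⟨c, d, hd, rfl⟩ := exists_fox_decomposition
          (Q := fun _ => wordSpan Z (shortWords X n))
          (fun L hL i => foxDeriv_mem_of_positive hL i) ha
        obtain ⟨rfl, h1⟩ := key c d h0
        have : d = 0 := Finsupp.ext fun i => ih _ (hd i) (h1 i)
        simp [this]
      intro a ha h0
      obtain ⟨c, d, hd, rfl⟩ := exists_fox_decomposition
        (Q := fun i => (wordSpan Z (positiveWords X n)).comap
          (LinearMap.mulLeft Z (MonoidAlgebra.of Z _ (FreeGroup.of i))))
        (fun L hL i => of_mul_foxDeriv_mem (Nat.le_of_lt_succ hL) i) ha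
      obtain ⟨rfl, h1⟩ := key c d h0
      have : d = 0 := Finsupp.ext fun i => by
        -- `φ (d i) = 0` implies `φ (i * d i) = 0`, and `i * d i` lies where injectivity is already
        -- known; the unit `i` is then cancelled.
        have h2 := pos _ (hd i) (by
          rw [LinearMap.mulLeft_apply, map_mul, h1, mul_zero])
        have hu : IsUnit (MonoidAlgebra.of Z _ (FreeGroup.of i)) :=
          (Group.isUnit (FreeGroup.of i)).map (MonoidAlgebra.of Z (FreeGroup X))
        exact hu.mul_right_eq_zero.mp h2
      simp [this]
  have exhaust : ∀ a : MonoidAlgebra Z (FreeGroup X),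
      ∃ n, a ∈ wordSpan Z (shortWords X n) := by
    intro a
    induction a using MonoidAlgebra.induction_on with
    | of g =>
      obtain ⟨L, rfl⟩ := Quot.exists_rep g
      exact ⟨L.length + 1, mem_wordSpan (L := L) (Nat.lt_succ_self _)⟩
    | add a b iha ihb =>
      obtain ⟨m, hm⟩ := iha
      obtain ⟨n, hn⟩ := ihb
      exact ⟨max m n, add_mem
        (wordSpan_mono (fun _ h => lt_of_lt_of_le h (le_max_left m n)) hm)
        (wordSpan_mono (fun _ h => lt_of_lt_of_le h (le_max_right m n)) hn)⟩
    | smul r a iha =>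
      obtain ⟨n, hn⟩ := iha
      exact ⟨n, Submodule.smul_mem _ r hn⟩
  rw [injective_iff_map_eq_zero]
  intro a ha
  obtain ⟨n, hn⟩ := exhaust a
  exact short n a hn ha

end FoxCalculus

/-! ### Supports of central series and of inverses. -/

namespace CrossedProduct

namespace Series

section Support

variable {K G A : Type*} [Ring K] [Group G] [LinearOrder G] [MulLeftStrictMono G]
  [MulRightStrictMono G] [Ring A] {C : CrossedProduct K G A}

theorem coeff_sum {ι : Type*} (s : Finset ι) (f : ι → C.Series) (x : G) :
    (∑ i ∈ s, f i).coeff x = ∑ i ∈ s, (f i).coeff x :=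
  map_sum ({ toFun := fun f => f.coeff x, map_zero' := rfl, map_add' := fun _ _ => rfl } :
    C.Series →+ K) f s

theorem single_one_mul_coeff_ne_zero_iff (x : G) (f : C.Series) (w : G) :
    (single C x 1 * f).coeff w ≠ 0 ↔ f.coeff (x⁻¹ * w) ≠ 0 := by
  rw [single_mul_coeff, map_one, mul_one]
  exact (Units.mul_right_eq_zero _).not

theorem mul_single_one_coeff_ne_zero_iff (x : G) (f : C.Series) (w : G) :
    (f * single C x 1).coeff w ≠ 0 ↔ f.coeff (w * x⁻¹) ≠ 0 := by
  rw [mul_single_coeff, mul_one]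
  refine ((Units.mul_right_eq_zero _).trans ?_).not
  simp

/-- The support of a series that commutes with the elements of `bar` consists of central
elements. -/
theorem mem_center_of_commute {z : C.Series}
    (hz : ∀ x : G, z * single C x 1 = single C x 1 * z) {g : G} (hg : z.coeff g ≠ 0) :
    g ∈ Subgroup.center G := by
  have hconj : ∀ x g : G, z.coeff g ≠ 0 ↔ z.coeff (x * g * x⁻¹) ≠ 0 := by
    intro x g
    rw [← mul_single_one_coeff_ne_zero_iff, hz, single_one_mul_coeff_ne_zero_iff,
      inv_mul_cancel_left]
  by_contra hgc
  -- The noncentral part of the support is stable under conjugation. Its minimum is at most each of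
  -- its conjugates; using both `x` and `x⁻¹` makes it equal to all of them, hence central, a
  -- contradiction.
  let T : Set G := {g | z.coeff g ≠ 0 ∧ g ∉ Subgroup.center G}
  have hT : T.IsWF := z.isWF_support.mono fun _ h => h.1
  have hne : T.Nonempty := ⟨g, hg, hgc⟩
  obtain ⟨h1, h2⟩ := hT.min_mem hne
  have hmin : ∀ x, hT.min hne ≤ x * hT.min hne * x⁻¹ := fun x => by
    refine hT.min_le hne ⟨(hconj x _).1 h1, fun h => h2 ?_⟩
    simpa [mul_assoc] using (inferInstance : (Subgroup.center G).Normal).conj_mem _ h x⁻¹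
  have := mulLeftMono_of_mulLeftStrictMono G
  have := mulRightMono_of_mulRightStrictMono G
  refine h2 (Subgroup.mem_center_iff.2 fun x => le_antisymm ?_ (le_mul_inv_iff_mul_le.1 (hmin x)))
  have := hmin x⁻¹
  rwa [inv_inv, mul_assoc, le_inv_mul_iff_mul_le] at this

/-- The subring of the series whose support is contained in a given submonoid. -/
def supportedSubring (C : CrossedProduct K G A) (N : Submonoid G) : Subring C.Series where
  carrier := {f | ∀ x, f.coeff x ≠ 0 → x ∈ N}
  zero_mem' := fun x h => absurd rfl h
  one_mem' := fun x h => by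
    by_contra hx
    refine h (single_of_ne 1 ?_)
    rintro rfl
    exact hx (one_mem N)
  add_mem' := fun {f g} hf hg x h => by
    by_contra hx
    have h1 : f.coeff x = 0 := by_contra fun h' => hx (hf x h')
    have h2 : g.coeff x = 0 := by_contra fun h' => hx (hg x h')
    exact h (by simp [h1, h2])
  neg_mem' := fun {f} hf x h => hf x (by simpa using h)
  mul_mem' := fun {f g} hf hg x h => by
    obtain ⟨y, hy⟩ : ∃ y, mulTerm f g x y ≠ 0 := by
      by_contra! h0
      exact h (finsum_eq_zero_of_forall_eq_zero h0)
    obtain ⟨h1, h2⟩ := mulTerm_support f g x hy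
    simpa using mul_mem (hf _ h1) (hg _ h2)

theorem mem_supportedSubring {N : Submonoid G} {f : C.Series} :
    f ∈ supportedSubring C N ↔ ∀ x, f.coeff x ≠ 0 → x ∈ N := Iff.rfl

theorem single_mem_supportedSubring {N : Submonoid G} {x : G} (hx : x ∈ N) (a : K) :
    single C x a ∈ supportedSubring C N := by
  intro y hy
  by_contra h
  refine hy (single_of_ne a ?_)
  rintro rfl
  exact h hx

/-- Descent replaces the geometric series: if `w` is the least support element of `g` outside `N`,
the coefficient of `(1 + x̄) g = 1` at `w ≠ 1` vanishes. So `x⁻¹ w < w` is also in the support, and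
it is outside `N` because `x` is in `N`. -/
theorem inverse_mem_supportedSubring {N : Submonoid G} {x : G} (hx : x ∈ N) (hx1 : 1 < x)
    {g : C.Series} (hg : (1 + single C x 1) * g = 1) : g ∈ supportedSubring C N := by
  by_contra hN
  rw [mem_supportedSubring] at hN
  push Not at hN
  let T : Set G := {w | g.coeff w ≠ 0 ∧ w ∉ N}
  have hT : T.IsWF := g.isWF_support.mono fun _ h => h.1
  have hne : T.Nonempty := hN
  obtain ⟨h1, h2⟩ := hT.min_mem hne
  set w := hT.min hne
  have hw1 : w ≠ 1 := fun h => h2 (h ▸ one_mem N)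
  have hw : g.coeff w + (single C x 1 * g).coeff w = 0 := by
    rw [add_mul, one_mul] at hg
    have := congrArg (fun f : C.Series => f.coeff w) hg
    simpa [one_def, single_of_ne (C := C) 1 hw1] using this
  have h3 : g.coeff (x⁻¹ * w) ≠ 0 := by
    rw [← single_one_mul_coeff_ne_zero_iff]
    intro h
    exact h1 (by simpa [h] using hw)
  have h4 : x⁻¹ * w ∉ N := fun h => h2 (by simpa using mul_mem hx h)
  have h5 : w ≤ x⁻¹ * w := hT.min_le hne ⟨h3, h4⟩
  have h6 : x⁻¹ * w < w := by
    rw [inv_mul_lt_iff_lt_mul]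
    exact lt_mul_of_one_lt_left' w hx1
  exact absurd h5 (not_le.2 h6)

end Support

end Series

/-! ### A free submonoid modulo the center of the group. -/

section FreeSubmonoid

variable {G : Type*} [Group G] {X : Set G}

/-- The submonoid generated by a subset of a group together with the center of the group. -/
def closureMulCenter (X : Set G) : Submonoid G where
  carrier := {h | ∃ w : FreeMonoid X, ∃ g ∈ Subgroup.center G,
    h = FreeMonoid.lift (fun x : X => (x : G)) w * g}
  one_mem' := ⟨1, 1, one_mem _, by simp⟩
  mul_mem' := by
    rintro _ _ ⟨w, g, hg, rfl⟩ ⟨w', g', hg', rfl⟩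
    refine ⟨w * w', g * g', mul_mem hg hg', ?_⟩
    rw [map_mul, mul_assoc, ← mul_assoc g, ← Subgroup.mem_center_iff.1 hg]
    simp only [mul_assoc]

theorem mem_closureMulCenter_of_mem {x : G} (hx : x ∈ X) : x ∈ closureMulCenter X :=
  ⟨FreeMonoid.of ⟨x, hx⟩, 1, one_mem _, by simp⟩

theorem mem_closureMulCenter_of_mem_center {g : G} (hg : g ∈ Subgroup.center G) :
    g ∈ closureMulCenter X :=
  ⟨1, g, hg, by simp⟩

variable [Nontrivial X]

/-- A nonempty `t` cannot commute with a letter `y` other than its first: `y t` and `t y` begin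
differently. -/
theorem eq_one_of_lift_mem_center
    (hfree : Function.Injective (FreeMonoid.lift (fun x : X => (x : G)))) {t : FreeMonoid X}
    (ht : FreeMonoid.lift (fun x : X => (x : G)) t ∈ Subgroup.center G) : t = 1 := by
  have hcomm : ∀ y : X, FreeMonoid.of y * t = t * FreeMonoid.of y := fun y =>
    hfree (by rw [map_mul, map_mul]; exact Subgroup.mem_center_iff.1 ht _)
  cases t using FreeMonoid.casesOn with
  | one => rfl
  | of_mul a t =>
    obtain ⟨y, hy⟩ := exists_ne a
    have := congrArg FreeMonoid.toList (hcomm y)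
    simp at this
    exact absurd this.1 hy

/-- Words that agree up to a central factor commute, so by freeness `w w' = w' w` as words. Hence
one is a prefix of the other, and the remaining factor is central, therefore empty. -/
theorem eq_of_lift_eq_lift_mul_center
    (hfree : Function.Injective (FreeMonoid.lift (fun x : X => (x : G)))) {w w' : FreeMonoid X} {g : G}
    (hg : g ∈ Subgroup.center G)
    (h : FreeMonoid.lift (fun x : X => (x : G)) w = FreeMonoid.lift (fun x : X => (x : G)) w' * g) :
    w = w' := by
  have hcomm : w * w' = w' * w := hfree (by
    rw [map_mul, map_mul, h, mul_assoc, ← Subgroup.mem_center_iff.1 hg])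
  have hlist := congrArg FreeMonoid.toList hcomm
  rw [FreeMonoid.toList_mul, FreeMonoid.toList_mul] at hlist
  rcases List.append_eq_append_iff.1 hlist with ⟨t, ht, -⟩ | ⟨t, ht, -⟩
  · have ht' : w' = w * FreeMonoid.ofList t := ht
    have : FreeMonoid.ofList t = 1 := eq_one_of_lift_mem_center hfree (by
      rw [ht', map_mul, mul_assoc, left_eq_mul] at h
      rw [eq_inv_of_mul_eq_one_left h]
      exact inv_mem hg)
    rw [ht', this, mul_one]
  · have ht' : w = w' * FreeMonoid.ofList t := ht
    have : FreeMonoid.ofList t = 1 := eq_one_of_lift_mem_center hfree (by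
      rw [ht', map_mul, mul_right_inj] at h
      rwa [h])
    rw [ht', this, mul_one]

/-- Separates the supports of the scalars from those of the terms `x̄ d x`. -/
theorem mul_notMem_center_of_mem_closureMulCenter
    (hfree : Function.Injective (FreeMonoid.lift (fun x : X => (x : G)))) (x : X) {n : G}
    (hn : n ∈ closureMulCenter X) : x * n ∉ Subgroup.center G := by
  rintro h
  obtain ⟨w, g, hg, rfl⟩ := hn
  have := eq_one_of_lift_mem_center hfree (t := FreeMonoid.of x * w) (by
    rw [map_mul, FreeMonoid.lift_eval_of]
    rw [← mul_assoc] at h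
    exact (Subgroup.mul_mem_cancel_right _ hg).1 h)
  simpa using congrArg FreeMonoid.toList this

/-- The sets `x N` are disjoint for distinct `x`: modulo the center, the first letter can be read
off. -/
theorem eq_of_mul_eq_mul_of_mem_closureMulCenter
    (hfree : Function.Injective (FreeMonoid.lift (fun x : X => (x : G)))) {x y : X} {n n' : G}
    (hn : n ∈ closureMulCenter X) (hn' : n' ∈ closureMulCenter X) (h : x * n = y * n') :
    x = y := by
  obtain ⟨w, g, hg, rfl⟩ := hn
  obtain ⟨w', g', hg', rfl⟩ := hn'
  have := eq_of_lift_eq_lift_mul_center hfree (w := FreeMonoid.of x * w)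
    (w' := FreeMonoid.of y * w') (mul_mem hg' (inv_mem hg)) (by
      rw [map_mul, map_mul, FreeMonoid.lift_eval_of, FreeMonoid.lift_eval_of, ← mul_assoc,
        eq_mul_inv_iff_mul_eq]
      simpa only [mul_assoc] using h)
  have := congrArg FreeMonoid.toList this
  simp at this
  exact this.1

end FreeSubmonoid

/-- At `x * n`, with `n` in the support of `d x`, neither `c` nor any other summand has a nonzero
coefficient, and that of `x̄ d x` is a unit times the coefficient of `d x` at `n`. -/
theorem Series.eq_zero_of_add_sum_single_mul_eq_zero {K G A : Type*} [Ring K] [Group G]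
    [LinearOrder G] [MulLeftStrictMono G] [MulRightStrictMono G] [Ring A]
    {C : CrossedProduct K G A} {X : Set G} [Nontrivial X]
    (hfree : Function.Injective (FreeMonoid.lift (fun x : X => (x : G)))) {c : C.Series}
    (hc : ∀ g, c.coeff g ≠ 0 → g ∈ Subgroup.center G) {s : Finset X} {d : X → C.Series}
    (hd : ∀ x, d x ∈ supportedSubring C (closureMulCenter X))
    (h : c + ∑ x ∈ s, single C (x : G) 1 * d x = 0) : c = 0 ∧ ∀ x ∈ s, d x = 0 := by
  have hds : ∀ x ∈ s, d x = 0 := by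
    intro x hx
    ext n
    rw [coeff_zero, Pi.zero_apply]
    by_contra hn
    have hnN := hd x n hn
    have h1 := congrArg (fun f : C.Series => f.coeff (x * n)) h
    simp only [coeff_add, Pi.add_apply, coeff_sum, coeff_zero, Pi.zero_apply] at h1
    have hc0 : c.coeff (x * n) = 0 := by
      by_contra h0
      exact mul_notMem_center_of_mem_closureMulCenter hfree x hnN (hc _ h0)
    rw [hc0, zero_add, Finset.sum_eq_single_of_mem x hx] at h1
    · refine (single_one_mul_coeff_ne_zero_iff (x : G) (d x) (x * n)).2 ?_ h1
      rwa [inv_mul_cancel_left]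
    · intro y _ hyx
      by_contra h0
      rw [← ne_eq, single_one_mul_coeff_ne_zero_iff] at h0
      refine hyx (eq_of_mul_eq_mul_of_mem_closureMulCenter hfree (hd y _ h0) hnN ?_)
      rw [mul_inv_cancel_left]
  refine ⟨?_, hds⟩
  rwa [Finset.sum_eq_zero (fun x hx => by rw [hds x hx, mul_zero]), add_zero] at h

/-! ### The group algebra over the center inside the skew field of fractions. -/

section FreeGroupAlgebra

variable {K G A : Type*} [DivisionRing K] [Group G] [LinearOrder G] [MulLeftStrictMono G]
  [MulRightStrictMono G] [Ring A] (C : CrossedProduct K G A)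

theorem coe_toFractions_bar (x : G) :
    (C.toFractions (C.bar x) : C.Series) = Series.single C x 1 := by
  rw [← Series.ofCrossedProduct_monomial, map_one, mul_one]
  rfl

theorem one_add_toFractions_bar_ne_zero {x : G} (hx : 1 < x) :
    1 + C.toFractions (C.bar x) ≠ 0 := by
  intro h
  have h1 := congrArg (fun f : C.fractions => (f : C.Series).coeff 1) h
  simp [coe_toFractions_bar, Series.one_def, Series.single_self,
    Series.single_of_ne (C := C) 1 hx.ne] at h1

/-- The unit `1 + x̄`, for `x` positive. -/
noncomputable def oneAddBar {x : G} (hx : 1 < x) : (C.fractions)ˣ :=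
  Units.mk0 _ (C.one_add_toFractions_bar_ne_zero hx)

variable {C} {X : Set G} (hpos : ∀ x ∈ X, 1 < x)

theorem coe_mem_center_of_mem_center {z : C.fractions} (hz : z ∈ Subring.center C.fractions)
    {g : G} (hg : (z : C.Series).coeff g ≠ 0) : g ∈ Subgroup.center G := by
  refine Series.mem_center_of_commute (fun x => ?_) hg
  have := congrArg (Subtype.val) (Subring.mem_center_iff.1 hz (C.toFractions (C.bar x)))
  rw [← coe_toFractions_bar]
  exact this.symm

theorem coe_lift_oneAddBar_mem (h : FreeGroup X) :
    (((FreeGroup.lift (fun x : X => C.oneAddBar (hpos x x.2)) h : (C.fractions)ˣ) :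
      C.fractions) : C.Series) ∈ Series.supportedSubring C (closureMulCenter X) := by
  induction h using FreeGroup.induction_on with
  | C1 => exact one_mem (Series.supportedSubring C (closureMulCenter X))
  | of x =>
    rw [FreeGroup.lift_apply_of]
    change (1 : C.Series) + (C.toFractions (C.bar x) : C.Series) ∈ _
    rw [coe_toFractions_bar]
    exact add_mem (one_mem _)
      (Series.single_mem_supportedSubring (mem_closureMulCenter_of_mem x.2) 1)
  | inv_of x _ =>
    rw [map_inv, FreeGroup.lift_apply_of]
    refine Series.inverse_mem_supportedSubring (mem_closureMulCenter_of_mem x.2) (hpos x x.2) ?_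
    rw [← coe_toFractions_bar]
    exact congrArg Subtype.val (C.oneAddBar (hpos x x.2)).mul_inv
  | mul a b ha hb =>
    rw [map_mul]
    exact mul_mem ha hb

/-- The homomorphism from the group algebra of the free group on `X` over the center that sends
each generator `x` to `1 + x̄`. -/
noncomputable def freeGroupAlgebraHom (C : CrossedProduct K G A) (hpos : ∀ x ∈ X, 1 < x) :
    MonoidAlgebra (Subring.center C.fractions) (FreeGroup X) →ₐ[Subring.center C.fractions]
      C.fractions :=
  MonoidAlgebra.lift (Subring.center C.fractions) C.fractions (FreeGroup X)
    ((Units.coeHom C.fractions).comp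
      (FreeGroup.lift fun x : X => C.oneAddBar (hpos x x.2)))

/-- The central factor in `closureMulCenter` is there to absorb the scalars, whose supports need not
lie in the submonoid generated by `X`. -/
theorem coe_freeGroupAlgebraHom_mem
    (a : MonoidAlgebra (Subring.center C.fractions) (FreeGroup X)) :
    (freeGroupAlgebraHom C hpos a : C.Series) ∈
      Series.supportedSubring C (closureMulCenter X) := by
  induction a using MonoidAlgebra.induction_on with
  | of g =>
    rw [freeGroupAlgebraHom, MonoidAlgebra.lift_of]
    exact coe_lift_oneAddBar_mem hpos g
  | add a b ha hb =>
    rw [map_add]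
    exact add_mem ha hb
  | smul r a ha =>
    rw [map_smul]
    exact mul_mem (fun g hg => mem_closureMulCenter_of_mem_center
      (coe_mem_center_of_mem_center r.2 hg)) ha

theorem freeGroupAlgebraHom_injective [Nontrivial X]
    (hfree : Function.Injective (FreeMonoid.lift (fun x : X => (x : G)))) :
    Function.Injective (freeGroupAlgebraHom C hpos) := by
  refine injective_of_fox_independent _ fun c d h => ?_
  have h1 := congrArg Subtype.val h
  have hof : ∀ x : X, freeGroupAlgebraHom C hpos (MonoidAlgebra.of _ _ (FreeGroup.of x)) - 1 =
      C.toFractions (C.bar x) := fun x => by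
    rw [freeGroupAlgebraHom, MonoidAlgebra.lift_of, MonoidHom.comp_apply, FreeGroup.lift_apply_of]
    exact add_sub_cancel_left 1 (C.toFractions (C.bar x))
  simp only [hof, Finsupp.sum] at h1
  have h2 : ((c : C.fractions) : C.Series) + ∑ x ∈ d.support,
      Series.single C (x : G) 1 * (freeGroupAlgebraHom C hpos (d x) : C.Series) = 0 := by
    rw [← ZeroMemClass.coe_zero C.fractions, ← h1, AddMemClass.coe_add, AddSubmonoidClass.coe_finsetSum]
    simp only [MulMemClass.coe_mul, coe_toFractions_bar]
    rfl
  obtain ⟨h3, h4⟩ := Series.eq_zero_of_add_sum_single_mul_eq_zero hfree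
    (fun g hg => coe_mem_center_of_mem_center c.2 hg)
    (fun x => coe_freeGroupAlgebraHom_mem hpos (d x)) h2
  refine ⟨Subtype.ext (Subtype.ext h3), fun x => ?_⟩
  by_cases hx : x ∈ d.support
  · exact Subtype.ext (h4 x hx)
  · rw [Finsupp.notMem_support_iff.1 hx, map_zero]

end FreeGroupAlgebra

end CrossedProduct

/-! ### The free subgroup and its group algebra. -/

theorem nontrivial_of_mul_ne_mul_mem_closure {G : Type*} [Monoid G] {X : Set G}
    (hnc : ∃ a ∈ Submonoid.closure X, ∃ b ∈ Submonoid.closure X, a * b ≠ b * a) :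
    Nontrivial X := by
  by_contra h
  rw [not_nontrivial_iff_subsingleton] at h
  obtain ⟨a, ha, b, hb, hab⟩ := hnc
  have hX : ∀ x ∈ X, ∀ y ∈ X, x * y = y * x := fun x hx y hy => by
    rw [Set.subsingleton_coe X |>.1 h hx hy]
  have := Submonoid.isMulCommutative_closure _ hX
  exact hab (congrArg Subtype.val
    (IsMulCommutative.is_comm.comm (⟨a, ha⟩ : Submonoid.closure X) ⟨b, hb⟩))

theorem mainTheorem4 {K G A : Type*} [DivisionRing K] [Group G] [LinearOrder G]
    [MulLeftStrictMono G] [MulRightStrictMono G] [Ring A] (C : CrossedProduct K G A)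
    (X : Set G) (hpos : ∀ x ∈ X, 1 < x)
    (hfree : Function.Injective (FreeMonoid.lift (fun x : X => (x : G))))
    (hnc : ∃ a ∈ Submonoid.closure X, ∃ b ∈ Submonoid.closure X, a * b ≠ b * a) :
    ∃ (H : Subgroup (C.fractions)ˣ) (b : FreeGroupBasis X H),
      (∀ x : X, ((b x : (C.fractions)ˣ) : C.fractions) = 1 + C.toFractions (C.bar x)) ∧
      (∃ g h : H, g * h ≠ h * g) ∧
      Function.Injective
        (MonoidAlgebra.lift (Subring.center C.fractions) C.fractions H
          ((Units.coeHom C.fractions).comp H.subtype)) := by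
  have := nontrivial_of_mul_ne_mul_mem_closure hnc
  let u : FreeGroup X →* (C.fractions)ˣ := FreeGroup.lift fun x : X => C.oneAddBar (hpos x x.2)
  have hinj := CrossedProduct.freeGroupAlgebraHom_injective (C := C) hpos hfree
  -- Freeness of the subgroup is read off from the algebra map, by restricting it to group elements.
  have hu : Function.Injective u := fun g h hgh => by
    refine MonoidAlgebra.of_injective (R := Subring.center C.fractions) (hinj ?_)
    rw [CrossedProduct.freeGroupAlgebraHom, MonoidAlgebra.lift_of, MonoidAlgebra.lift_of]
    exact congrArg Units.val hgh
  let e : FreeGroup X ≃* u.range := MonoidHom.ofInjective hu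
  refine ⟨u.range, FreeGroupBasis.ofRepr e.symm, fun x => ?_, ?_, ?_⟩
  · change ((u (FreeGroup.of x) : (C.fractions)ˣ) : C.fractions) = _
    rw [FreeGroup.lift_apply_of]
    rfl
  · obtain ⟨x, y, hxy⟩ := exists_pair_ne X
    refine ⟨e (FreeGroup.of x), e (FreeGroup.of y), fun h => hxy ?_⟩
    rw [← map_mul, ← map_mul] at h
    have := congrArg FreeGroup.toWord (e.injective h)
    classical
    simp [FreeGroup.toWord_mul, FreeGroup.reduce] at this
    exact this.1
  -- The natural map on the group algebra of `u.range` is the injective map already found,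
  -- transported along `e`.
  · have hcomp : CrossedProduct.freeGroupAlgebraHom C hpos =
        (MonoidAlgebra.lift (Subring.center C.fractions) C.fractions u.range
          ((Units.coeHom C.fractions).comp u.range.subtype)).comp
          (MonoidAlgebra.domCongr _ (Subring.center C.fractions) e).toAlgHom := by
      refine MonoidAlgebra.algHom_ext (fun g => ?_) (Subsingleton.elim _ _)
      rw [CrossedProduct.freeGroupAlgebraHom, AlgHom.comp_apply, AlgEquiv.toAlgHom_apply,
        MonoidAlgebra.domCongr_single, MonoidAlgebra.lift_single, MonoidAlgebra.lift_single]
      rfl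
    rw [hcomp] at hinj
    exact Function.Injective.of_comp_right hinj (AlgEquiv.surjective _)
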